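/- Let $d\ge 1$ and let $\mathcal X_d=\{\langle k,i\rangle : k\ge 0,\ 1\le i\le d\}$ be a countable set of types; the type $\langle k,i\rangle$ is said to be in level $k$. For each type $j$ let $p_j$ be a probability distribution on the vectors $\boldsymbol r\in\mathbb N_0^{\mathcal X_d}$ such that, if $j$ is in level $k$, then $p_j$ is supported on vectors with $r_\ell=0$ for all types $\ell$ in levels above $k+1$. Let $\{\boldsymbol Z_n\}_{n\ge0}$ be the multitype Galton--Watson process with these offspring laws (a block lower Hessenberg branching process): each individual lives for one generation, and an individual of type $j$ has $r_\ell$ children of type $\ell$ for each $\ell$, where $\boldsymbol r$ has law $p_j$ and is independent of the offspring vectors of all other individuals. $Z_{n,\ell}$ is the number of type-$\ell$ individuals in generation $n$, and $\mathbb P_i$ is the law of the process started from a single individual of type $i$. Let $M(i,j)=\sum_{\boldsymbol r}p_i(\boldsymbol r)\,r_j\in[0,\infty]$ be the expected number of type-$j$ children of a type-$i$ individual, and consider the directed graph on $\mathcal X_d$ with an edge from $i$ to $j$ whenever $M(i,j)>0$. Let $T_k$ be the set of types in levels $0,\dots,k$. For $A\subseteq\mathcal X_d$ and $i\in\mathcal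 X_d$ define: - $q_i(A)=\mathbb P_i\big(\exists n\ \forall m\ge n\ \forall \ell\in A:\ Z_{m,\ell}=0\big)$, the probability of eventual extinction in $A$; - $\{\tilde{\boldsymbol Z}{}^{(A)}_n\}$, the process obtained from $\{\boldsymbol Z_n\}$ by making all individuals with type outside $A$ sterile (they have no children), and $\tilde q^{(A)}_i$, the probability under $\mathbb P_i$ that this process becomes globally extinct, that is, that it is empty from some generation on; - for $k,\ell\ge0$, $q^{(k,\ell)}_i(A)$, the probability under $\mathbb P_i$ that $\{\tilde{\boldsymbol Z}{}^{(A\cup T_\ell)}_n\}$ becomes globally extinct without ever containing an individual (the initial one included) with type in $A\setminus T_k$. Equivalently, this is the extinction probability of the process modified so that the types in $A\setminus T_k$ are immortal and the types outside $A\cup T_\ell$ are sterile. **Theorem.** Let $A\subseteq\mathcal X_d$ be such that from every type there is a path (possibly of length zero) in this graph to some type in $A$; this holds in particular if $A\neq\varnothing$ and the process is irreducible, that is, any two types are joined by a path in each direction. If $$\sup_{i\in A}\tilde q^{(A)}_i<1,$$ then $$\lim_{k\to\infty}q^{(k,k)}_i(A)=q_i(A)\qquad\text{for every } i\in\mathcal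 X_d .$$ -/

import Mathlib

open MeasureTheory Filter Topology
open scoped ENNReal

/-- The type set: a type `(k, i)` is in level `k` and phase `i`. -/
abbrev TypeSet (d : ℕ) : Type := ℕ × Fin d

/-- Offspring vectors. In a block lower Hessenberg process an individual has no offspring beyond
the next level, so that all its possible offspring vectors have finite support. -/
abbrev Offspring (d : ℕ) : Type := TypeSet d →₀ ℕ

instance Offspring.instMeasurableSpace (d : ℕ) : MeasurableSpace (Offspring d) := ⊤

/-- The reproduction laws of a block lower Hessenberg branching process with `d` phases:
`p i` is the law of the offspring vector of an individual of type `i`, and an individual in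
level `k` has no offspring in any level above `k + 1`. -/
structure BlockLHBP (d : ℕ) where
  p : TypeSet d → PMF (Offspring d)
  lowerHessenberg : ∀ i : TypeSet d, ∀ r ∈ (p i).support,
    ∀ j : TypeSet d, i.1 + 1 < j.1 → r j = 0

/-- Virtual individuals. `(i, [(cₙ, jₙ), …, (c₁, j₁)])` is the child number `cₙ` of type `jₙ` of
the individual `(i, [(cₙ₋₁, jₙ₋₁), …, (c₁, j₁)])`, and `(i, [])` is the root, which has type `i`.
The children of each type are numbered from `0` on. -/
abbrev Individual (d : ℕ) : Type := TypeSet d × List (ℕ × TypeSet d)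

/-- The type of a virtual individual. -/
def Individual.type {d : ℕ} : Individual d → TypeSet d
  | (i, []) => i
  | (_, (_, j) :: _) => j

/-- The sample space: an offspring vector for each virtual individual. -/
abbrev SampleSpace (d : ℕ) : Type := Individual d → Offspring d

/-- The population in generation `n` when the root has type `i` and the offspring vectors are
given by `N`. -/
def population {d : ℕ} (N : SampleSpace d) (i : TypeSet d) : ℕ → Set (Individual d)
  | 0 => {(i, [])}
  | n + 1 => {x | ∃ y ∈ population N i n, ∃ (c : ℕ) (j : TypeSet d),
      c < N y j ∧ x = (y.1, (c, j) :: y.2)}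

/-- `popVector N i n j` is the number of type-`j` individuals in generation `n`, when the root has
type `i`. -/
noncomputable def popVector {d : ℕ} (N : SampleSpace d) (i : TypeSet d) (n : ℕ)
    (j : TypeSet d) : ℕ∞ :=
  {x ∈ population N i n | x.type = j}.encard

/-- The event that, from generation `n` on, no individual with type in `A` is in the population
that starts with a root of type `i`. -/
def extinctFrom {d : ℕ} (i : TypeSet d) (A : Set (TypeSet d)) (n : ℕ) : Set (SampleSpace d) :=
  {N | ∀ m, n ≤ m → ∀ j ∈ A, popVector N i m j = 0}

/-- The event of eventual extinction in `A`. -/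
def extinct {d : ℕ} (i : TypeSet d) (A : Set (TypeSet d)) : Set (SampleSpace d) :=
  ⋃ n, extinctFrom i A n

open Classical in
/-- The offspring vectors after all individuals with type outside `A` have been made sterile. -/
noncomputable def sterilize {d : ℕ} (A : Set (TypeSet d)) (N : SampleSpace d) : SampleSpace d :=
  fun I => if I.type ∈ A then N I else 0

/-- The types whose level is at most `k`. -/
def levelsUpTo (d k : ℕ) : Set (TypeSet d) := {i | i.1 ≤ k}

namespace BlockLHBP

variable {d : ℕ} (Z : BlockLHBP d)

/-- The law of the family of offspring vectors: they are independent, and an individual of type `i`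
has an offspring vector with law `p i`. -/
noncomputable def prob : Measure (SampleSpace d) :=
  Measure.infinitePi fun I : Individual d => (Z.p I.type).toMeasure

/-- The mean progeny matrix: `mean i j` is the expected number of type-`j` children of an
individual of type `i`. -/
noncomputable def mean (i j : TypeSet d) : ℝ≥0∞ := ∑' r : Offspring d, Z.p i r * (r j : ℝ≥0∞)

/-- There is a path (of length at least zero) from `i` to `j` in the mean progeny representation
graph, which has an edge from `a` to `b` if and only if `mean a b > 0`. -/
def HasPath (i j : TypeSet d) : Prop := Relation.ReflTransGen (fun a b => 0 < Z.mean a b) i j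

/-- The probability `q_i(A)` of eventual extinction in `A`, starting from a root of type `i`. -/
noncomputable def q (A : Set (TypeSet d)) (i : TypeSet d) : ℝ≥0∞ := Z.prob (extinct i A)

/-- The global extinction probability of the process in which all individuals with type outside
`A` are sterile. -/
noncomputable def qSterile (A : Set (TypeSet d)) (i : TypeSet d) : ℝ≥0∞ :=
  Z.prob {N | sterilize A N ∈ extinct i Set.univ}

/-- The extinction probability of the truncated process, in which the types outside `A` in a level
above `l` are sterile and the types in `A` in a level above `k` are immortal: the probability that
the process in which all individuals with type outside `A ∪ levelsUpTo d l` are sterile becomes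
globally extinct without ever containing an individual with type in `A \ levelsUpTo d k`. -/
noncomputable def qTrunc (A : Set (TypeSet d)) (k l : ℕ) (i : TypeSet d) : ℝ≥0∞ :=
  Z.prob {N | sterilize (A ∪ levelsUpTo d l) N ∈ extinct i Set.univ ∧
    sterilize (A ∪ levelsUpTo d l) N ∈ extinctFrom i (A \ levelsUpTo d k) 0}

end BlockLHBP

/-! Let `B` be a set of types such that, with probability bounded below by a positive constant, the
family tree of an individual with type in `B` has a property `G`. By the branching property, each
visit to `B` bounds from below the conditional probability, given the past, that `G` holds for the
family tree of some individual in an arbitrarily late generation. By Lévy's zero-one law, `G`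
therefore occurs infinitely often whenever `B` is visited in infinitely many generations.

With `B` a finite set of levels and `G` the event of hitting `A`, eventual extinction in `A` implies
eventual extinction in every finite set of levels. With `B = A` and `G` the survival of the process
in which the types outside `A ∪ levelsUpTo d m` are sterile, for some `m`, non-extinction in `A`
implies that the process sterilized outside `A ∪ levelsUpTo d l` survives for all large `l`, since
a given individual is born in it once `l` exceeds the levels of its ancestors. Conversely, on
extinction in `A` only finitely many individuals ever have a type in `A`, so their levels are
bounded. Almost surely, the truncated process thus dies out for all large truncation levels if and
only if there is extinction in `A`, and dominated convergence concludes.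
-/

open ProbabilityTheory

section LevyZeroOne

variable {Ω : Type*}

theorem ae_mem_of_frequently_le_condExp {mΩ : MeasurableSpace Ω} {μ : Measure Ω}
    [IsFiniteMeasure μ] {ℱ : Filtration ℕ mΩ} {s : Set Ω} (hs : MeasurableSet[⨆ n, ℱ n] s)
    {c : ℝ} (hc : 0 < c) :
    ∀ᵐ ω ∂μ, (∃ᶠ n in atTop, c ≤ (μ⟦s | ℱ n⟧) ω) → ω ∈ s := by
  have hs' : MeasurableSet s := iSup_le ℱ.le s hs
  have levy := ((integrable_const (1 : ℝ)).indicator hs').tendsto_ae_condExp (μ := μ)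
    (stronglyMeasurable_const.indicator hs)
  filter_upwards [levy] with ω hω hfreq
  by_contra hωs
  rw [Set.indicator_of_notMem hωs] at hω
  exact hfreq ((hω.eventually_lt_const hc).mono fun _ => not_le.2)

theorem ae_measureReal_le_condExp_of_inter_subset {m m' mΩ : MeasurableSpace Ω} {μ : Measure Ω}
    [IsFiniteMeasure μ] (hm : m ≤ mΩ) (hm' : m' ≤ mΩ) (hind : Indep m' m μ)
    {s t u : Set Ω} (hs : MeasurableSet[m] s) (ht : MeasurableSet[m'] t) (hu : MeasurableSet u)
    (hstu : s ∩ t ⊆ u) : ∀ᵐ ω ∂μ, ω ∈ s → μ.real t ≤ (μ⟦u | m⟧) ω := by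
  have integrable_one {v : Set Ω} (hv : MeasurableSet v) :
      Integrable (v.indicator fun _ => (1 : ℝ)) μ := (integrable_const _).indicator hv
  have condExp_t : μ⟦t | m⟧ =ᵐ[μ] fun _ => μ.real t := by
    refine (condExp_indep_eq hm' hm (stronglyMeasurable_const.indicator ht) hind).trans ?_
    simp only [integral_indicator_const (1 : ℝ) (hm' t ht), smul_eq_mul, mul_one, EventuallyEq.rfl]
  have condExp_inter : μ⟦s ∩ t | m⟧ =ᵐ[μ] s.indicator (μ⟦t | m⟧) := by
    rw [← Set.indicator_indicator]
    exact condExp_indicator (integrable_one (hm' t ht)) hs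
  have condExp_le : μ⟦s ∩ t | m⟧ ≤ᵐ[μ] μ⟦u | m⟧ :=
    condExp_mono (integrable_one ((hm s hs).inter (hm' t ht))) (integrable_one hu)
      (.of_forall (Set.indicator_le_indicator_of_subset hstu fun _ => zero_le_one))
  filter_upwards [condExp_t, condExp_inter, condExp_le] with ω ht_eq hinter hle hωs
  rwa [hinter, Set.indicator_of_mem hωs, ht_eq] at hle

theorem indep_cylinderEvents_infinitePi {ι : Type*} {X : ι → Type*}
    [∀ i, MeasurableSpace (X i)] (P : ∀ i, Measure (X i)) [∀ i, IsProbabilityMeasure (P i)]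
    {S T : Set ι} (hST : Disjoint S T) :
    Indep (cylinderEvents S) (cylinderEvents T) (Measure.infinitePi P) :=
  indep_iSup_of_disjoint (fun i => (measurable_pi_apply i).comap_le)
    (iIndepFun_infinitePi (P := P) (X := fun _ x => x) fun _ => measurable_id) hST

end LevyZeroOne

instance Offspring.instDiscreteMeasurableSpace (d : ℕ) : DiscreteMeasurableSpace (Offspring d) :=
  ⟨fun _ => trivial⟩

/-- A line of descent from the root: the second component of a virtual individual. It lists the
child numbers and the types, the youngest individual first, so that `l ++ u` is the continuation of
the line `u` by the line `l`. -/
abbrev Lineage (d : ℕ) : Type := List (ℕ × TypeSet d)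

/-- A realization of the process from a single root: an offspring vector for each virtual
descendant of the root. The type of the root is not recorded. -/
abbrev FamilyTree (d : ℕ) : Type := Lineage d → Offspring d

theorem Individual.type_append {d : ℕ} (i : TypeSet d) (l u : Lineage d) :
    Individual.type (i, l ++ u) = Individual.type (Individual.type (i, u), l) := by
  cases l <;> rfl

namespace FamilyTree

variable {d : ℕ} {M : FamilyTree d} {A B : Set (TypeSet d)} {i : TypeSet d} {l u : Lineage d}
  {n : ℕ}

/-- `M.Alive l` says that the virtual individual at the end of the line of descent `l` is born in
the tree `M`. -/
def Alive (M : FamilyTree d) : Lineage d → Prop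
  | [] => True
  | (c, j) :: l => Alive M l ∧ c < M l j

/-- The family tree of the individual at the end of the line of descent `u`. -/
def shift (u : Lineage d) (M : FamilyTree d) : FamilyTree d := fun l => M (l ++ u)

open Classical in
/-- The family tree after all individuals with type outside `A` have been made sterile, when the
root has type `i`; the counterpart of `sterilize`. -/
noncomputable def sterile (A : Set (TypeSet d)) (i : TypeSet d) (M : FamilyTree d) :
    FamilyTree d :=
  fun l => if Individual.type (i, l) ∈ A then M l else 0

/-- The trees with a root of type `i` in which no individual of generation `n` or later has a type
in `A`; the counterpart of `extinctFrom`. -/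
def extinctFrom (i : TypeSet d) (A : Set (TypeSet d)) (n : ℕ) : Set (FamilyTree d) :=
  {M | ∀ l : Lineage d, n ≤ l.length → M.Alive l → Individual.type (i, l) ∉ A}

/-- The event of eventual extinction in `A` for trees with a root of type `i`; the counterpart of
`extinct`. -/
def extinct (i : TypeSet d) (A : Set (TypeSet d)) : Set (FamilyTree d) :=
  ⋃ n, extinctFrom i A n

theorem alive_append : M.Alive (l ++ u) ↔ M.Alive u ∧ (M.shift u).Alive l := by
  induction l with
  | nil => simp only [List.nil_append, Alive, and_true]
  | cons a l ih => simp only [List.cons_append, Alive, ih, shift, and_assoc]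

theorem shift_sterile :
    (M.sterile A i).shift u = (M.shift u).sterile A (Individual.type (i, u)) := by
  funext l
  simp only [shift, sterile]
  rw [Individual.type_append]

theorem alive_sterile_cons {a : ℕ × TypeSet d} :
    (M.sterile A i).Alive (a :: l) ↔
      (M.sterile A i).Alive l ∧ Individual.type (i, l) ∈ A ∧ a.1 < M l a.2 := by
  by_cases h : Individual.type (i, l) ∈ A <;> simp [Alive, sterile, h]

theorem Alive.sterile_mono (hAB : A ⊆ B) (h : (M.sterile A i).Alive l) :
    (M.sterile B i).Alive l := by
  induction l with
  | nil => trivial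
  | cons a l ih =>
    rw [alive_sterile_cons] at h ⊢
    exact ⟨ih h.1, hAB h.2.1, h.2.2⟩

theorem Alive.of_sterile (h : (M.sterile A i).Alive l) : M.Alive l := by
  induction l with
  | nil => trivial
  | cons a l ih =>
    rw [alive_sterile_cons] at h
    exact ⟨ih h.1, h.2.2⟩

theorem Alive.eventually_sterile (h : M.Alive l) (A : Set (TypeSet d)) (i : TypeSet d) :
    ∀ᶠ k in atTop, (M.sterile (A ∪ levelsUpTo d k) i).Alive l := by
  induction l with
  | nil => exact .of_forall fun _ => trivial
  | cons a l ih =>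
    filter_upwards [ih h.1, eventually_ge_atTop (Individual.type (i, l)).1] with k hl hk
    exact alive_sterile_cons.2 ⟨hl, .inr hk, h.2⟩

theorem finite_setOf_alive_length_eq (M : FamilyTree d) (n : ℕ) :
    {l : Lineage d | M.Alive l ∧ l.length = n}.Finite := by
  induction n with
  | zero => exact (Set.finite_singleton []).subset fun l hl => List.length_eq_zero_iff.1 hl.2
  | succ n ih =>
    have finite_children (l : Lineage d) : {a : ℕ × TypeSet d | a.1 < M l a.2}.Finite := by
      refine ((M l).support.finite_toSet.biUnion fun j _ =>
        (Set.finite_Iio (M l j)).image fun c => (c, j)).subset ?_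
      intro a ha
      exact Set.mem_biUnion (Finsupp.mem_support_iff.2 (Nat.ne_zero_of_lt ha)) ⟨a.1, ha, rfl⟩
    refine (ih.biUnion fun l _ => (finite_children l).image (· :: l)).subset ?_
    rintro (_ | ⟨a, l⟩) ⟨halive, hlength⟩
    · cases hlength
    · exact Set.mem_biUnion ⟨halive.1, Nat.succ_injective hlength⟩ ⟨a, halive.2, rfl⟩

theorem finite_setOf_alive_length_lt (M : FamilyTree d) (n : ℕ) :
    {l : Lineage d | M.Alive l ∧ l.length < n}.Finite :=
  ((Set.finite_Iio n).biUnion fun m _ => M.finite_setOf_alive_length_eq m).subset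
    fun _ hl => Set.mem_biUnion hl.2 ⟨hl.1, rfl⟩

theorem notMem_extinctFrom : M ∉ extinctFrom i A n ↔
    ∃ l : Lineage d, n ≤ l.length ∧ M.Alive l ∧ Individual.type (i, l) ∈ A := by
  simp only [extinctFrom, Set.mem_ofPred_eq, not_forall, not_not, exists_prop]

theorem mem_extinct : M ∈ extinct i A ↔ ∃ n, M ∈ extinctFrom i A n := Set.mem_iUnion

theorem notMem_extinct : M ∉ extinct i A ↔ ∀ n, M ∉ extinctFrom i A n := by
  rw [mem_extinct, not_exists]

theorem notMem_extinctFrom_of_shift (hu : M.Alive u)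
    (h : M.shift u ∉ extinctFrom (Individual.type (i, u)) A n) :
    M ∉ extinctFrom i A (n + u.length) := by
  obtain ⟨l, hn, hl, hA⟩ := notMem_extinctFrom.1 h
  refine notMem_extinctFrom.2 ⟨l ++ u, ?_, alive_append.2 ⟨hu, hl⟩, ?_⟩
  · rw [List.length_append]
    exact Nat.add_le_add_right hn _
  · rwa [Individual.type_append]

theorem extinctFrom_mono {m : ℕ} (hmn : m ≤ n) : extinctFrom i A m ⊆ extinctFrom i A n :=
  fun _ h l hl => h l (hmn.trans hl)

theorem extinct_inter_subset_extinct_union :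
    extinct i A ∩ extinct i B ⊆ extinct i (A ∪ B) := by
  rintro M ⟨hA, hB⟩
  obtain ⟨m, hm⟩ := mem_extinct.1 hA
  obtain ⟨n, hn⟩ := mem_extinct.1 hB
  refine mem_extinct.2 ⟨max m n, fun l hl halive => ?_⟩
  rintro (h | h)
  · exact hm l ((le_max_left m n).trans hl) halive h
  · exact hn l ((le_max_right m n).trans hl) halive h

theorem sterile_mem_extinct_univ (h : M ∈ extinct i A) :
    M.sterile A i ∈ extinct i Set.univ := by
  obtain ⟨n, hn⟩ := mem_extinct.1 h
  refine mem_extinct.2 ⟨n + 1, ?_⟩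
  rintro (_ | ⟨a, l⟩) hl halive -
  · cases hl
  · have hparent := alive_sterile_cons.1 halive
    exact hn l (Nat.le_of_succ_le_succ hl) hparent.1.of_sterile hparent.2.1

theorem sterile_mem_extinctFrom (h : M ∈ extinctFrom i B n) : M.sterile A i ∈ extinctFrom i B n :=
  fun l hl halive => h l hl halive.of_sterile

theorem sterile_mem_extinct_of_subset (hAB : A ⊆ B) (h : M.sterile B i ∈ extinct i Set.univ) :
    M.sterile A i ∈ extinct i Set.univ := by
  obtain ⟨n, hn⟩ := mem_extinct.1 h
  exact mem_extinct.2 ⟨n, fun l hl halive => hn l hl (halive.sterile_mono hAB)⟩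

theorem eventually_mem_extinctFrom_diff_levelsUpTo (h : M ∈ extinct i A) :
    ∀ᶠ k in atTop, M ∈ extinctFrom i (A \ levelsUpTo d k) 0 := by
  obtain ⟨n, hn⟩ := mem_extinct.1 h
  obtain ⟨K, hK⟩ := ((M.finite_setOf_alive_length_lt n).image
    fun l => (Individual.type (i, l)).1).bddAbove
  filter_upwards [eventually_ge_atTop K] with k hk l _ halive hl
  have hlength : l.length < n := not_le.1 fun hnl => hn l hnl halive hl.1
  exact hl.2 ((hK ⟨l, ⟨halive, hlength⟩, rfl⟩).trans hk)

theorem eventually_sterile_notMem_extinct (hu : M.Alive u) {m : ℕ}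
    (hsurv : (M.shift u).sterile (A ∪ levelsUpTo d m) (Individual.type (i, u)) ∉
      extinct (Individual.type (i, u)) Set.univ) :
    ∀ᶠ k in atTop, M.sterile (A ∪ levelsUpTo d k) i ∉ extinct i Set.univ := by
  filter_upwards [hu.eventually_sterile A i, eventually_ge_atTop m] with k hk hmk
  have hmono : A ∪ levelsUpTo d m ⊆ A ∪ levelsUpTo d k :=
    Set.union_subset_union_right A fun _ hj => le_trans hj hmk
  have hsurv' := mt (sterile_mem_extinct_of_subset hmono) hsurv
  rw [← shift_sterile, notMem_extinct] at hsurv'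
  exact notMem_extinct.2 fun n hn =>
    notMem_extinctFrom_of_shift hk (hsurv' n) (extinctFrom_mono (Nat.le_add_right _ _) hn)

/-- The filtration of the process: at time `n`, the offspring vectors of the virtual individuals in
the generations before `n` are known, which determines the population in generation `n`. -/
def generationFiltration (d : ℕ) :
    Filtration ℕ (MeasurableSpace.pi : MeasurableSpace (FamilyTree d)) where
  seq n := cylinderEvents {l | l.length < n}
  mono' _ _ h := cylinderEvents_mono fun _ hl => lt_of_lt_of_le hl h
  le' _ := cylinderEvents_le_pi

theorem measurable_apply_generationFiltration (h : l.length < n) :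
    Measurable[generationFiltration d n] fun M : FamilyTree d => M l :=
  measurable_cylinderEvent_apply (Δ := {l : Lineage d | l.length < n}) h

theorem iSup_generationFiltration (d : ℕ) :
    ⨆ n, generationFiltration d n = (MeasurableSpace.pi : MeasurableSpace (FamilyTree d)) := by
  refine le_antisymm (iSup_le (generationFiltration d).le) (iSup_le fun l => ?_)
  exact le_iSup_of_le (l.length + 1)
    (measurable_apply_generationFiltration (Nat.lt_succ_self l.length)).comap_le

theorem measurableSet_alive_generationFiltration (l : Lineage d) :
    MeasurableSet[generationFiltration d l.length] {M : FamilyTree d | M.Alive l} := by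
  induction l with
  | nil => exact .univ
  | cons a l ih =>
    have hborn : MeasurableSet[generationFiltration d (a :: l).length]
        {M : FamilyTree d | a.1 < M l a.2} :=
      measurable_apply_generationFiltration (Nat.lt_succ_self l.length)
        (MeasurableSet.of_discrete (s := {r : Offspring d | a.1 < r a.2}))
    exact ((generationFiltration d).mono (Nat.le_succ _) _ ih).inter hborn

theorem measurableSet_alive (l : Lineage d) : MeasurableSet {M : FamilyTree d | M.Alive l} :=
  (generationFiltration d).le _ _ (measurableSet_alive_generationFiltration l)

theorem measurable_shift_cylinderEvents (u : Lineage d) :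
    Measurable[cylinderEvents {l : Lineage d | u.length ≤ l.length}] (shift (d := d) u) :=
  @measurable_pi_iff _ _ _ (_) _ _ |>.2 fun l =>
    measurable_cylinderEvent_apply (i := l ++ u) (by simp)

theorem measurable_shift (u : Lineage d) : Measurable (shift (d := d) u) :=
  (measurable_shift_cylinderEvents u).mono cylinderEvents_le_pi le_rfl

theorem measurable_sterile (A : Set (TypeSet d)) (i : TypeSet d) : Measurable (sterile A i) := by
  refine measurable_pi_iff.2 fun l => ?_
  by_cases h : Individual.type (i, l) ∈ A
  · simpa only [sterile, h, if_true] using measurable_pi_apply l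
  · simpa only [sterile, h, if_false] using measurable_const

theorem measurableSet_extinctFrom (i : TypeSet d) (A : Set (TypeSet d)) (n : ℕ) :
    MeasurableSet (extinctFrom i A n) := by
  simp only [extinctFrom, Set.ofPred_forall]
  exact .iInter fun l => .iInter fun _ => (measurableSet_alive l).imp (.const _)

theorem measurableSet_extinct (i : TypeSet d) (A : Set (TypeSet d)) :
    MeasurableSet (extinct i A) := .iUnion (measurableSet_extinctFrom i A)

end FamilyTree

/-- The family tree of the root of type `i`, which carries the events of the process started from
that root over to trees. -/
def SampleSpace.tree {d : ℕ} (i : TypeSet d) (N : SampleSpace d) : FamilyTree d :=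
  fun l => N (i, l)

theorem mem_population_iff {d : ℕ} {N : SampleSpace d} {i : TypeSet d} {n : ℕ}
    {x : Individual d} :
    x ∈ population N i n ↔ x.1 = i ∧ x.2.length = n ∧ (SampleSpace.tree i N).Alive x.2 := by
  induction n generalizing x with
  | zero =>
    obtain ⟨r, l⟩ := x
    simp only [population, Set.mem_singleton_iff, Prod.mk.injEq, List.length_eq_zero_iff]
    constructor
    · rintro ⟨rfl, rfl⟩; exact ⟨rfl, rfl, trivial⟩
    · rintro ⟨h, h', -⟩; exact ⟨h, h'⟩
  | succ n ih =>
    simp only [population, Set.mem_ofPred_eq, ih]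
    constructor
    · rintro ⟨⟨r, l⟩, ⟨rfl, hl, ha⟩, c, j, hc, rfl⟩
      exact ⟨rfl, congrArg (· + 1) hl, ha, hc⟩
    · obtain ⟨r, _ | ⟨⟨c, j⟩, l⟩⟩ := x
      · rintro ⟨-, hl, -⟩; cases hl
      · rintro ⟨rfl, hl, ha, hc⟩
        exact ⟨(r, l), ⟨rfl, Nat.succ_injective hl, ha⟩, c, j, hc, rfl⟩

theorem mem_extinctFrom_iff_tree {d : ℕ} {N : SampleSpace d} {i : TypeSet d}
    {A : Set (TypeSet d)} {n : ℕ} :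
    N ∈ extinctFrom i A n ↔ SampleSpace.tree i N ∈ FamilyTree.extinctFrom i A n := by
  simp only [extinctFrom, FamilyTree.extinctFrom, popVector, Set.mem_ofPred_eq,
    Set.encard_eq_zero, Set.eq_empty_iff_forall_notMem, mem_population_iff]
  constructor
  · intro h l hl ha hA
    exact h _ hl _ hA (i, l) ⟨⟨rfl, rfl, ha⟩, rfl⟩
  · rintro h m hm j hj ⟨r, l⟩ ⟨⟨rfl, rfl, ha⟩, rfl⟩
    exact h l hm ha hj

theorem mem_extinct_iff_tree {d : ℕ} {N : SampleSpace d} {i : TypeSet d} {A : Set (TypeSet d)} :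
    N ∈ extinct i A ↔ SampleSpace.tree i N ∈ FamilyTree.extinct i A := by
  simp only [extinct, FamilyTree.extinct, Set.mem_iUnion, mem_extinctFrom_iff_tree]

namespace BlockLHBP

open FamilyTree

variable {d : ℕ} (Z : BlockLHBP d) {A B : Set (TypeSet d)}

/-- The law `ℙ_i` of the family tree of a root of type `i`: the offspring vectors of the virtual
descendants are independent, and their laws are given by the types. -/
noncomputable def treeLaw (i : TypeSet d) : Measure (FamilyTree d) :=
  Measure.infinitePi fun l : Lineage d => (Z.p (Individual.type (i, l))).toMeasure

instance isProbabilityMeasure_treeLaw (i : TypeSet d) :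
    IsProbabilityMeasure (Z.treeLaw i) := by
  unfold treeLaw; infer_instance

theorem measurePreserving_tree (i : TypeSet d) :
    MeasurePreserving (SampleSpace.tree i) Z.prob (Z.treeLaw i) where
  measurable := measurable_pi_iff.2 fun l => measurable_pi_apply (i, l)
  map_eq := Measure.map_infinitePi_infinitePi_of_inj
    (P := fun I : Individual d => (Z.p I.type).toMeasure) (Prod.mk_right_injective i)

theorem q_eq_treeLaw (A : Set (TypeSet d)) (i : TypeSet d) :
    Z.q A i = Z.treeLaw i (FamilyTree.extinct i A) := by
  rw [q, ← (Z.measurePreserving_tree i).measure_preimage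
    (FamilyTree.measurableSet_extinct i A).nullMeasurableSet]
  exact congrArg _ (Set.ext fun N => mem_extinct_iff_tree)

theorem qSterile_eq_treeLaw (A : Set (TypeSet d)) (i : TypeSet d) :
    Z.qSterile A i = Z.treeLaw i (sterile A i ⁻¹' FamilyTree.extinct i Set.univ) := by
  rw [qSterile, ← (Z.measurePreserving_tree i).measure_preimage
    (measurable_sterile A i (measurableSet_extinct i _)).nullMeasurableSet]
  exact congrArg _ (Set.ext fun N => mem_extinct_iff_tree)

theorem qTrunc_eq_treeLaw (A : Set (TypeSet d)) (k l : ℕ) (i : TypeSet d) :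
    Z.qTrunc A k l i = Z.treeLaw i (sterile (A ∪ levelsUpTo d l) i ⁻¹'
      (FamilyTree.extinct i Set.univ ∩ FamilyTree.extinctFrom i (A \ levelsUpTo d k) 0)) := by
  rw [qTrunc, ← (Z.measurePreserving_tree i).measure_preimage
    (measurable_sterile _ i ((measurableSet_extinct i _).inter
      (measurableSet_extinctFrom i _ 0))).nullMeasurableSet]
  exact congrArg _ (Set.ext fun N => and_congr mem_extinct_iff_tree mem_extinctFrom_iff_tree)

theorem qSterile_antitone (hAB : A ⊆ B) (i : TypeSet d) : Z.qSterile B i ≤ Z.qSterile A i := by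
  simp only [qSterile_eq_treeLaw]
  exact measure_mono fun _ => sterile_mem_extinct_of_subset hAB

theorem measurePreserving_shift (i : TypeSet d) (u : Lineage d) :
    MeasurePreserving (shift u) (Z.treeLaw i) (Z.treeLaw (Individual.type (i, u))) where
  measurable := measurable_shift u
  map_eq := by
    simp only [treeLaw, ← Individual.type_append]
    exact Measure.map_infinitePi_infinitePi_of_inj
      (P := fun l : Lineage d => (Z.p (Individual.type (i, l))).toMeasure)
      (List.append_left_injective u)

theorem indep_shift_generationFiltration (i : TypeSet d) (u : Lineage d) :
    Indep (cylinderEvents {l : Lineage d | u.length ≤ l.length})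
      (generationFiltration d u.length) (Z.treeLaw i) :=
  indep_cylinderEvents_infinitePi _ (Set.disjoint_left.2 fun l (hl : u.length ≤ l.length) =>
    not_lt.2 hl)

theorem treeLaw_alive_inter_shift (i : TypeSet d) (u : Lineage d) {G : Set (FamilyTree d)}
    (hG : MeasurableSet G) :
    Z.treeLaw i ({M | M.Alive u} ∩ shift u ⁻¹' G) =
      Z.treeLaw i {M | M.Alive u} * Z.treeLaw (Individual.type (i, u)) G := by
  have hind := (Indep_iff _ _ _).1 (Z.indep_shift_generationFiltration i u) _ _
    (measurable_shift_cylinderEvents u hG) (measurableSet_alive_generationFiltration u)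
  rw [Set.inter_comm, hind, mul_comm,
    (Z.measurePreserving_shift i u).measure_preimage hG.nullMeasurableSet]

theorem treeLaw_alive_child_pos {i j : TypeSet d} (hij : 0 < Z.mean i j) :
    0 < Z.treeLaw i {M | M.Alive [(0, j)]} := by
  obtain ⟨r, hr⟩ : ∃ r, Z.p i r * (r j : ℝ≥0∞) ≠ 0 := by
    by_contra! h
    exact hij.ne' (ENNReal.tsum_eq_zero.2 h)
  have hborn : {M : FamilyTree d | M.Alive [(0, j)]} =
      Function.eval ([] : Lineage d) ⁻¹' {r : Offspring d | 0 < r j} := by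
    ext M
    exact iff_of_eq (true_and _)
  rw [hborn, treeLaw, (measurePreserving_eval_infinitePi _ ([] : Lineage d)).measure_preimage
    MeasurableSet.of_discrete.nullMeasurableSet, pos_iff_ne_zero, Ne,
    PMF.toMeasure_apply_eq_zero_iff _ MeasurableSet.of_discrete, Set.not_disjoint_iff]
  exact ⟨r, ((Z.p i).mem_support_iff r).2 (left_ne_zero_of_mul hr),
    Nat.pos_of_ne_zero (Nat.cast_ne_zero.1 (right_ne_zero_of_mul hr))⟩

theorem treeLaw_compl_extinctFrom_zero_pos {i j : TypeSet d} (hij : Z.HasPath i j)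
    (hj : j ∈ A) : 0 < Z.treeLaw i (FamilyTree.extinctFrom i A 0)ᶜ := by
  induction hij using Relation.ReflTransGen.head_induction_on with
  | refl =>
    have hroot : (FamilyTree.extinctFrom j A 0)ᶜ = Set.univ := Set.eq_univ_of_forall fun M =>
      notMem_extinctFrom.2 ⟨[], le_rfl, trivial, hj⟩
    rw [hroot, measure_univ]
    exact one_pos
  | @head a b hab _ ih =>
    refine (ENNReal.mul_pos (Z.treeLaw_alive_child_pos hab).ne' ih.ne').trans_le ?_
    refine (Z.treeLaw_alive_inter_shift a [(0, b)]
      (FamilyTree.measurableSet_extinctFrom b A 0).compl).ge.trans (measure_mono ?_)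
    rintro M ⟨hborn, hM⟩ hext
    exact notMem_extinctFrom_of_shift hborn hM (extinctFrom_mono (Nat.zero_le _) hext)

theorem ae_le_condExp_of_alive (i : TypeSet d) (u : Lineage d) {G H : Set (FamilyTree d)}
    (hG : MeasurableSet G) (hH : MeasurableSet H) (hGH : {M | M.Alive u} ∩ shift u ⁻¹' G ⊆ H) :
    ∀ᵐ M ∂Z.treeLaw i, Alive M u → (Z.treeLaw (Individual.type (i, u))).real G ≤
      ((Z.treeLaw i)⟦H | generationFiltration d u.length⟧) M := by
  rw [← (Z.measurePreserving_shift i u).measureReal_preimage hG.nullMeasurableSet]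
  exact ae_measureReal_le_condExp_of_inter_subset ((generationFiltration d).le _)
    cylinderEvents_le_pi (Z.indep_shift_generationFiltration i u)
    (measurableSet_alive_generationFiltration u) (measurable_shift_cylinderEvents u hG) hH hGH

theorem ae_exists_shift_mem (i : TypeSet d) {G : TypeSet d → Set (FamilyTree d)}
    (hG : ∀ j, MeasurableSet (G j)) {c : ℝ} (hc : 0 < c)
    (hGc : ∀ j ∈ B, c ≤ (Z.treeLaw j).real (G j)) :
    ∀ᵐ M ∂Z.treeLaw i, M ∉ FamilyTree.extinct i B → ∀ n, ∃ u : Lineage d,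
      n ≤ u.length ∧ Alive M u ∧ M ∈ shift u ⁻¹' G (Individual.type (i, u)) := by
  suffices exists_le : ∀ n, ∀ᵐ M ∂Z.treeLaw i, M ∉ FamilyTree.extinct i B → ∃ u : Lineage d,
      n ≤ u.length ∧ Alive M u ∧ M ∈ shift u ⁻¹' G (Individual.type (i, u)) by
    filter_upwards [ae_all_iff.2 exists_le] with M hM hext n using hM n hext
  intro n
  set H : Set (FamilyTree d) := {M | ∃ u : Lineage d,
    n ≤ u.length ∧ M.Alive u ∧ M ∈ shift u ⁻¹' G (Individual.type (i, u))}
  have hH : MeasurableSet H := by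
    simp only [H, Set.ofPred_exists]
    exact .iUnion fun u => (MeasurableSet.const _).inter
      ((measurableSet_alive u).inter (measurable_shift u (hG _)))
  have condExp_ge : ∀ᵐ M ∂Z.treeLaw i, ∀ u : Lineage d, n ≤ u.length →
      Individual.type (i, u) ∈ B → Alive M u →
      c ≤ ((Z.treeLaw i)⟦H | generationFiltration d u.length⟧) M := by
    simp only [ae_all_iff]
    intro u hn hB
    filter_upwards [Z.ae_le_condExp_of_alive i u (hG _) hH fun M hM => ⟨u, hn, hM⟩] with M hM halive
    exact (hGc _ hB).trans (hM halive)
  filter_upwards [ae_mem_of_frequently_le_condExp ((iSup_generationFiltration d).symm ▸ hH) hc,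
    condExp_ge] with M levy hM hext
  refine levy (frequently_atTop.2 fun m => ?_)
  obtain ⟨u, hu, halive, hB⟩ := notMem_extinctFrom.1 (notMem_extinct.1 hext (max m n))
  exact ⟨u.length, (le_max_left m n).trans hu, hM u ((le_max_right m n).trans hu) hB halive⟩

theorem ae_mem_extinct_of_forall_le_compl_extinctFrom (i : TypeSet d) {c : ℝ} (hc : 0 < c)
    (h : ∀ j ∈ B, c ≤ (Z.treeLaw j).real (FamilyTree.extinctFrom j A 0)ᶜ) :
    ∀ᵐ M ∂Z.treeLaw i, M ∈ FamilyTree.extinct i A → M ∈ FamilyTree.extinct i B := by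
  filter_upwards [Z.ae_exists_shift_mem i
    (fun j => (FamilyTree.measurableSet_extinctFrom j A 0).compl) hc h] with M hM
  contrapose!
  refine fun hB => notMem_extinct.2 fun n hn => ?_
  obtain ⟨u, hu, halive, hhit⟩ := hM hB n
  exact notMem_extinctFrom_of_shift halive hhit (extinctFrom_mono (by omega) hn)

theorem ae_mem_extinct_of_finite (i : TypeSet d) (hB : B.Finite)
    (hA : ∀ j ∈ B, ∃ a ∈ A, Z.HasPath j a) :
    ∀ᵐ M ∂Z.treeLaw i, M ∈ FamilyTree.extinct i A → M ∈ FamilyTree.extinct i B := by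
  have hpos : ∀ j ∈ B, 0 < (Z.treeLaw j).real (FamilyTree.extinctFrom j A 0)ᶜ := fun j hj => by
    obtain ⟨a, ha, hpath⟩ := hA j hj
    exact ENNReal.toReal_pos (Z.treeLaw_compl_extinctFrom_zero_pos hpath ha).ne'
      (measure_ne_top _ _)
  obtain ⟨c, hc, hcB⟩ : ∃ c > 0, ∀ j ∈ B,
      c ≤ (Z.treeLaw j).real (FamilyTree.extinctFrom j A 0)ᶜ := by
    obtain rfl | hne := B.eq_empty_or_nonempty
    · exact ⟨1, one_pos, fun _ => False.elim⟩
    · obtain ⟨b, hb, hmin⟩ := Set.exists_min_image B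
        (fun j => (Z.treeLaw j).real (FamilyTree.extinctFrom j A 0)ᶜ) hB hne
      exact ⟨_, hpos b hb, hmin⟩
  exact Z.ae_mem_extinct_of_forall_le_compl_extinctFrom i hc hcB

theorem ae_exists_shift_sterile_notMem_extinct {ι : Type*} [Countable ι] (i : TypeSet d)
    {C : ι → Set (TypeSet d)} (hC : (⨆ j ∈ A, ⨅ m, Z.qSterile (C m) j) < 1) :
    ∀ᵐ M ∂Z.treeLaw i, M ∉ FamilyTree.extinct i A → ∃ (u : Lineage d) (m : ι), Alive M u ∧
      (shift u M).sterile (C m) (Individual.type (i, u)) ∉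
        FamilyTree.extinct (Individual.type (i, u)) Set.univ := by
  obtain ⟨s, hsup, hs⟩ := exists_between hC
  set survives : TypeSet d → ι → Set (FamilyTree d) := fun j m =>
    (sterile (C m) j ⁻¹' FamilyTree.extinct j Set.univ)ᶜ
  have measurableSet_extinct_sterile (j m) :
      MeasurableSet (sterile (C m) j ⁻¹' FamilyTree.extinct j Set.univ) :=
    measurable_sterile _ j (FamilyTree.measurableSet_extinct j _)
  have hG (j) : MeasurableSet (⋃ m, survives j m) :=
    .iUnion fun m => (measurableSet_extinct_sterile j m).compl
  have hGc : ∀ j ∈ A, 1 - s.toReal ≤ (Z.treeLaw j).real (⋃ m, survives j m) := fun j hj => by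
    obtain ⟨m, hm⟩ := iInf_lt_iff.1 ((le_iSup₂ (f := fun j (_ : j ∈ A) =>
      ⨅ m, Z.qSterile (C m) j) j hj).trans_lt hsup)
    rw [qSterile_eq_treeLaw] at hm
    calc 1 - s.toReal
        ≤ 1 - (Z.treeLaw j).real (sterile (C m) j ⁻¹' FamilyTree.extinct j Set.univ) :=
          sub_le_sub_left (ENNReal.toReal_mono hs.ne_top hm.le) 1
      _ = (Z.treeLaw j).real (survives j m) :=
          (probReal_compl_eq_one_sub (measurableSet_extinct_sterile j m)).symm
      _ ≤ (Z.treeLaw j).real (⋃ m, survives j m) :=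
          measureReal_mono (Set.subset_iUnion (survives j) m)
  have hc : 0 < 1 - s.toReal :=
    sub_pos.2 (ENNReal.toReal_lt_of_lt_ofReal (hs.trans_eq ENNReal.ofReal_one.symm))
  filter_upwards [Z.ae_exists_shift_mem i hG hc hGc] with M hM hext
  obtain ⟨u, -, halive, hu⟩ := hM hext 0
  obtain ⟨m, hm⟩ := Set.mem_iUnion.1 hu
  exact ⟨u, m, halive, hm⟩

end BlockLHBP

theorem finite_levelsUpTo (d k : ℕ) : (levelsUpTo d k).Finite :=
  ((Set.finite_Iic k).prod Set.finite_univ).subset fun _ hi => ⟨hi, trivial⟩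

theorem mainTheorem5_general {d : ℕ} (Z : BlockLHBP d) (A : Set (TypeSet d))
    (hA : ∀ i : TypeSet d, ∃ j ∈ A, Z.HasPath i j)
    (hsup : (⨆ i ∈ A, ⨅ m, Z.qSterile (A ∪ levelsUpTo d m) i) < 1) :
    Tendsto (fun kl : ℕ × ℕ => Z.qTrunc A kl.1 kl.2) (atTop ×ˢ atTop) (𝓝 (Z.q A)) := by
  refine tendsto_pi_nhds.2 fun i => ?_
  simp only [Z.qTrunc_eq_treeLaw, Z.q_eq_treeLaw]
  refine tendsto_measure_of_ae_tendsto_indicator_of_isFiniteMeasure _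
    (FamilyTree.measurableSet_extinct i A) (fun kl => FamilyTree.measurable_sterile _ i
      ((FamilyTree.measurableSet_extinct i _).inter
        (FamilyTree.measurableSet_extinctFrom i _ 0))) ?_
  have levels_extinct := ae_all_iff.2 fun l =>
    Z.ae_mem_extinct_of_finite i (finite_levelsUpTo d l) fun j _ => hA j
  filter_upwards [levels_extinct, Z.ae_exists_shift_sterile_notMem_extinct i hsup] with M hT hS
  by_cases hM : M ∈ FamilyTree.extinct i A
  · filter_upwards [(FamilyTree.eventually_mem_extinctFrom_diff_levelsUpTo hM).prod_inl atTop]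
      with kl hk
    have hl := FamilyTree.extinct_inter_subset_extinct_union ⟨hM, hT kl.2 hM⟩
    exact iff_of_true ⟨FamilyTree.sterile_mem_extinct_univ hl,
      FamilyTree.sterile_mem_extinctFrom hk⟩ hM
  · obtain ⟨u, m, halive, hu⟩ := hS hM
    filter_upwards [(FamilyTree.eventually_sterile_notMem_extinct halive hu).prod_inr atTop]
      with kl hl
    exact iff_of_false (fun h => hl h.1) hM

theorem mainTheorem5 {d : ℕ} (Z : BlockLHBP d) (A : Set (TypeSet d))
    (hA : ∀ i : TypeSet d, ∃ j ∈ A, Z.HasPath i j)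
    (hsup : (⨆ i ∈ A, Z.qSterile A i) < 1) :
    Tendsto (fun k : ℕ => Z.qTrunc A k k) atTop (𝓝 (Z.q A)) := by
  have hsup' : (⨆ i ∈ A, ⨅ m, Z.qSterile (A ∪ levelsUpTo d m) i) < 1 := lt_of_le_of_lt
    (iSup₂_mono fun i _ => iInf_le_of_le 0 (Z.qSterile_antitone Set.subset_union_left i)) hsup
  have hdiag : Tendsto (fun k : ℕ => (k, k)) atTop (atTop ×ˢ atTop) :=
    tendsto_id.prodMk tendsto_id
  simpa only [Function.comp_def] using (mainTheorem5_general Z A hA hsup').comp hdiag
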